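/- Let $p$ be a prime with $p \equiv 1 \pmod 8$, let $k = \mathbb{Q}(\sqrt{p}) \subset \mathbb{R}$ with ring of integers $\mathcal{O}_k$, and let $\varepsilon > 0$ be a unit of $\mathcal{O}_k$ whose norm to $\mathbb{Q}$ is $-1$. Then the field $k(\sqrt{\varepsilon})$ has odd class number. -/

import Mathlib

open scoped NumberField

/-- The real quadratic field `ℚ(√p)`, as a subfield of `ℝ`. -/
noncomputable abbrev quadField (p : ℕ) : IntermediateField ℚ ℝ :=
  IntermediateField.adjoin ℚ {√(p : ℝ)}

instance quadField.numberField (p : ℕ) : NumberField (quadField p) where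
  to_finiteDimensional := by
    have h : IsIntegral ℚ (√(p : ℝ)) :=
      ⟨Polynomial.X ^ 2 - Polynomial.C (p : ℚ), Polynomial.monic_X_pow_sub_C _ two_ne_zero, by
        simp⟩
    have h' : FiniteDimensional ℚ (quadField p) := IntermediateField.adjoin.finiteDimensional h
    convert h'

/-- The field `k(√ε) ⊆ ℝ`, where `k = ℚ(√p)` and `ε ∈ k`; it is used for `ε > 0` only. -/
noncomputable abbrev sqrtExt (p : ℕ) (ε : quadField p) : IntermediateField (quadField p) ℝ :=
  IntermediateField.adjoin (quadField p) {√(ε : ℝ)}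

instance sqrtExt.numberField (p : ℕ) (ε : quadField p) : NumberField (sqrtExt p ε) where
  to_finiteDimensional := by
    have h : IsIntegral (quadField p) (√(ε : ℝ)) := by
      rcases le_or_gt 0 (ε : ℝ) with hε | hε
      · refine ⟨Polynomial.X ^ 2 - Polynomial.C ε, Polynomial.monic_X_pow_sub_C _ two_ne_zero, ?_⟩
        simp [IntermediateField.algebraMap_apply, Real.sq_sqrt hε]
      · rw [Real.sqrt_eq_zero_of_nonpos hε.le]
        exact isIntegral_zero
    have h' : FiniteDimensional (quadField p) (sqrtExt p ε) :=
      IntermediateField.adjoin.finiteDimensional h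
    exact FiniteDimensional.trans ℚ (quadField p) (sqrtExt p ε)

/-! ### Involutions of a Dedekind domain and the 2-part of its class group -/

section Involution

variable {O : Type*} [CommRing O] {σ : O ≃+* O}

/-! Genus theory for an involution `σ`, applied to k over ℚ and then to L = k(√ε) over k. By
`odd_card_classGroup`, the class number is odd once every `σ`-invariant ideal has a principal odd
power and every unit that is a quotient of norms is the norm of a unit.

For k, an invariant ideal is a rational ideal up to the principal ramified prime (√p), and the units
±1 are norms because ε has norm -1. So the class number h of k is odd.

For L, the prime 2 splits in k as q q' because p ≡ 1 mod 8. Labelled suitably, ε ≡ 1 mod q'², so q'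
contributes nothing, while ε ≡ -1 but not 1 mod q², so q = P² in L. Hence every invariant ideal
times a power of P comes from k, and P must be shown to have odd order in the class group. The unit
rank grows from k to L, so some unit η of relative norm one is not ± the square of such a unit. By
Hilbert 90, η = b/σ(b), and (b)Pⁱ comes from k for some i. For i even, ηʰ and then η would be ± such
a square; so i is odd and Pⁱʰ is principal. As for units, ε is negative at the other real place of
k, so a quotient of norms is positive there; only v² and -εv² remain, the norms of v and v√ε. -/

theorem Ideal.isPrincipal_pow {I : Ideal O} (h : I.IsPrincipal) (n : ℕ) :
    (I ^ n).IsPrincipal := by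
  obtain ⟨a, rfl⟩ := h
  exact ⟨a ^ n, by simp [Ideal.submodule_span_eq, Ideal.span_singleton_pow]⟩

theorem Ideal.isPrincipal_mul {I J : Ideal O} (h : I.IsPrincipal) (h' : J.IsPrincipal) :
    (I * J).IsPrincipal := by
  obtain ⟨a, rfl⟩ := h
  obtain ⟨b, rfl⟩ := h'
  exact ⟨a * b, by simp [Ideal.submodule_span_eq, Ideal.span_singleton_mul_span_singleton]⟩

/-- Hilbert's Theorem 90 for an involution, without denominators. -/
theorem exists_mul_eq_mul_of_norm_eq [IsDomain O] (hσ : ∀ x, σ (σ x) = x) (hne : ∃ s, σ s ≠ s)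
    {x y : O} (hx : x ≠ 0) (h : y * σ y = x * σ x) :
    ∃ b, b ≠ 0 ∧ σ b * y = x * b := by
  -- The usual resolvent s + (y/x)σ(s), cleared of denominators. It is nonzero at s = 1 unless y =
  -- -x, when any s moved by `σ` serves.
  have key : ∀ s, σ (σ x * (x * s + y * σ s)) * y = x * (σ x * (x * s + y * σ s)) := by
    intro s
    simp only [map_mul, map_add, hσ]
    linear_combination (x * s) * h
  have hσx : σ x ≠ 0 := by simpa using hx
  by_cases h1 : x + y = 0
  · obtain ⟨s, hs⟩ := hne
    refine ⟨_, ?_, key s⟩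
    refine mul_ne_zero hσx ?_
    have : x * s + y * σ s = x * (s - σ s) := by linear_combination σ s * h1
    rw [this]
    exact mul_ne_zero hx (sub_ne_zero.mpr hs.symm)
  · exact ⟨_, mul_ne_zero hσx (by simpa using h1), key 1⟩

theorem Ideal.map_map_involution (hσ : ∀ x, σ (σ x) = x) (I : Ideal O) :
    (I.map σ).map σ = I := by
  refine le_antisymm ?_ fun x hx ↦ ?_
  · rw [Ideal.map_le_iff_le_comap, Ideal.map_le_iff_le_comap]
    intro x hx
    rw [Ideal.mem_comap, Ideal.mem_comap, hσ]
    exact hx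
  · rw [← hσ x]
    exact Ideal.mem_map_of_mem _ (Ideal.mem_map_of_mem _ hx)

variable [IsDedekindDomain O]

theorem isPrincipal_of_mul_isPrincipal {I J : Ideal O} (hI : I ≠ ⊥) (hJ : J ≠ ⊥)
    (h : (I * J).IsPrincipal) (h' : J.IsPrincipal) : I.IsPrincipal := by
  have hI' : I ∈ nonZeroDivisors (Ideal O) := mem_nonZeroDivisors_of_ne_zero hI
  have hJ' : J ∈ nonZeroDivisors (Ideal O) := mem_nonZeroDivisors_of_ne_zero hJ
  have h1 := (ClassGroup.mk0_eq_one_iff (mul_mem hI' hJ')).mpr h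
  have h2 := (ClassGroup.mk0_eq_one_iff hJ').mpr h'
  have h3 : ClassGroup.mk0 ⟨I * J, mul_mem hI' hJ'⟩ =
    ClassGroup.mk0 ⟨I, hI'⟩ * ClassGroup.mk0 ⟨J, hJ'⟩ := by rw [← map_mul]; rfl
  rw [← ClassGroup.mk0_eq_one_iff hI']
  rw [h3, h2, mul_one] at h1
  exact h1

theorem isPrincipal_of_sq_of_odd_pow {I : Ideal O} (hI : I ≠ ⊥) (h2 : (I ^ 2).IsPrincipal)
    {m : ℕ} (hm : Odd m) (h : (I ^ m).IsPrincipal) : I.IsPrincipal := by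
  obtain ⟨n, rfl⟩ := hm
  refine isPrincipal_of_mul_isPrincipal (J := (I ^ 2) ^ n) hI
    (pow_ne_zero _ (pow_ne_zero _ hI)) ?_ (Ideal.isPrincipal_pow h2 n)
  rwa [← pow_mul, ← pow_succ']

/-- For a class [I] of order two, I·σ(I) is invariant with principal square, hence principal, so
σ(I) lies in the class of I. The unit hypothesis and Hilbert 90 then replace I by an invariant ideal
bI. An odd power of it is principal, which forces I to be principal. -/
theorem odd_card_classGroup [Fintype (ClassGroup O)]
    (hσ : ∀ x, σ (σ x) = x) (hne : ∃ s, σ s ≠ s)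
    (hinv : ∀ I : Ideal O, I ≠ ⊥ → I.map σ = I → ∃ m, Odd m ∧ (I ^ m).IsPrincipal)
    (hunit : ∀ (u : Oˣ) (x y : O), x ≠ 0 → y * σ y = u * (x * σ x) → ∃ w : Oˣ, w * σ w = (u : O)) :
    Odd (Fintype.card (ClassGroup O)) := by
  by_contra hodd
  rw [Nat.not_odd_iff_even, even_iff_two_dvd] at hodd
  obtain ⟨c, hc⟩ := exists_prime_orderOf_dvd_card 2 hodd
  obtain ⟨⟨I, hI⟩, rfl⟩ := ClassGroup.mk0_surjective c
  have hI0 : I ≠ ⊥ := nonZeroDivisors.ne_zero hI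
  have hsq : (I ^ 2).IsPrincipal := by
    rw [← ClassGroup.mk0_eq_one_iff (pow_mem hI 2)]
    have := pow_orderOf_eq_one (ClassGroup.mk0 ⟨I, hI⟩)
    rw [hc, ← map_pow] at this
    exact this
  have hnp : ¬ I.IsPrincipal := by
    rw [← ClassGroup.mk0_eq_one_iff hI, ← orderOf_eq_one_iff, hc]
    norm_num
  apply hnp
  have hσI0 : I.map σ ≠ ⊥ := by
    rw [Ne, Ideal.map_eq_bot_iff_of_injective σ.injective]
    exact hI0
  have hsqσ : ((I.map σ) ^ 2).IsPrincipal := by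
    obtain ⟨a, ha⟩ := hsq
    refine ⟨σ a, ?_⟩
    rw [← Ideal.map_pow, ha]
    simp [Ideal.submodule_span_eq, Ideal.map_span]
  have hprod : (I * I.map σ).IsPrincipal := by
    obtain ⟨m, hm, hp⟩ := hinv (I * I.map σ) (mul_ne_zero hI0 hσI0)
      (by rw [Ideal.map_mul, Ideal.map_map_involution hσ, mul_comm])
    exact isPrincipal_of_sq_of_odd_pow (mul_ne_zero hI0 hσI0)
      (by rw [mul_pow]; exact Ideal.isPrincipal_mul hsq hsqσ) hm hp
  -- Generators of I² and of I·σ(I): both sides are then I²·σ(I).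
  obtain ⟨x, y, hx, hy, hxy⟩ : ∃ x y : O, x ≠ 0 ∧ y ≠ 0 ∧
      Ideal.span {x} * I.map σ = Ideal.span {y} * I := by
    obtain ⟨a, ha⟩ := hsq
    obtain ⟨b, hb⟩ := hprod
    rw [Ideal.submodule_span_eq] at ha hb
    refine ⟨a, b, ?_, ?_, ?_⟩
    · rintro rfl
      exact pow_ne_zero 2 hI0 (by simpa using ha)
    · rintro rfl
      exact mul_ne_zero hI0 hσI0 (by simpa using hb)
    · rw [← ha, ← hb]; ring
  have hassoc : Associated (x * σ x) (y * σ y) := by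
    rw [← Ideal.span_singleton_eq_span_singleton]
    have h1 := congrArg (Ideal.map σ) hxy
    simp only [Ideal.map_mul, Ideal.map_map_involution hσ, Ideal.map_span,
      Set.image_singleton] at h1
    refine mul_right_cancel₀ hI0 ?_
    rw [← Ideal.span_singleton_mul_span_singleton, ← Ideal.span_singleton_mul_span_singleton,
      mul_assoc, h1, mul_left_comm, hxy]
    ring
  obtain ⟨u, hu⟩ := hassoc
  obtain ⟨w, hw⟩ := hunit u x y hx (by rw [← hu]; ring)
  have hxw : Ideal.span {(w : O) * x} = Ideal.span {x} := by
    rw [Ideal.span_singleton_eq_span_singleton]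
    exact (associated_unit_mul_left x (w : O) w.isUnit)
  obtain ⟨b, hb, hbe⟩ := exists_mul_eq_mul_of_norm_eq hσ hne (x := w * x) (y := y)
    (mul_ne_zero w.ne_zero hx) (by rw [← hu, ← hw, map_mul]; ring)
  have hbI : (Ideal.span {b} * I).map σ = Ideal.span {b} * I := by
    have hy' : Ideal.span {y} ≠ ⊥ := by simpa using hy
    have hx' : Ideal.span {(w : O) * x} ≠ ⊥ := by simpa using hx
    refine mul_left_cancel₀ hx' (mul_left_cancel₀ hy' ?_)
    have h2 : Ideal.span {σ b} * Ideal.span {y} = Ideal.span {(w : O) * x} * Ideal.span {b} := by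
      rw [Ideal.span_singleton_mul_span_singleton, hbe, Ideal.span_singleton_mul_span_singleton]
    rw [← hxw] at hxy
    simp only [Ideal.map_mul, Ideal.map_span, Set.image_singleton]
    calc _ = (Ideal.span {σ b} * Ideal.span {y}) * (Ideal.span {(w : O) * x} * I.map σ) := by ring
      _ = _ := by rw [h2, hxy]; ring
  have hb' : Ideal.span {b} ≠ ⊥ := by simpa using hb
  have hbp : (Ideal.span {b}).IsPrincipal := ⟨b, rfl⟩
  obtain ⟨m, hm, hp⟩ := hinv _ (mul_ne_zero hb' hI0) hbI
  refine isPrincipal_of_sq_of_odd_pow hI0 hsq hm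
    (isPrincipal_of_mul_isPrincipal (pow_ne_zero _ hI0) (pow_ne_zero m hb') ?_
      (Ideal.isPrincipal_pow hbp m))
  rwa [mul_comm, ← mul_pow]

end Involution

/-! ### Invariant ideals, fixed units and descent to the base ring -/

section Different

variable {A B : Type*} [CommRing A] [CommRing B] [Algebra A B] {σ : B ≃+* B}

/-- Traces of elements of I lie in I ∩ A, and (θ - σθ)x = θ·Tr(x) - Tr(x·σθ). Thus differents bound
the distance of an invariant ideal from an extended one. -/
theorem sub_mul_mem_map_comap (hσ : ∀ x, σ (σ x) = x)
    (hfix : ∀ x, σ x = x → ∃ a, algebraMap A B a = x) {I : Ideal B} (hI : I.map σ = I)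
    (θ : B) {x : B} (hx : x ∈ I) :
    (θ - σ θ) * x ∈ (I.comap (algebraMap A B)).map (algebraMap A B) := by
  have htr : ∀ z ∈ I, z + σ z ∈ (I.comap (algebraMap A B)).map (algebraMap A B) := by
    intro z hz
    obtain ⟨a, ha⟩ := hfix (z + σ z) (by rw [map_add, hσ, add_comm])
    rw [← ha]
    refine Ideal.mem_map_of_mem _ ?_
    rw [Ideal.mem_comap, ha]
    refine I.add_mem hz ?_
    rw [← hI]
    exact Ideal.mem_map_of_mem _ hz
  have h1 := Ideal.mul_mem_left _ θ (htr x hx)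
  have h2 := htr (x * σ θ) (I.mul_mem_right _ hx)
  have h3 := Ideal.sub_mem _ h1 h2
  convert h3 using 1
  rw [map_mul, hσ]
  ring

end Different

theorem NumberField.isPrincipal_pow_classNumber {K : Type*} [Field K] [NumberField K]
    (I : Ideal (𝓞 K)) (hI : I ≠ ⊥) : (I ^ NumberField.classNumber K).IsPrincipal := by
  have hI' : I ∈ nonZeroDivisors (Ideal (𝓞 K)) := mem_nonZeroDivisors_of_ne_zero hI
  rw [← ClassGroup.mk0_eq_one_iff (pow_mem hI' _)]
  have h : ClassGroup.mk0 ⟨I, hI'⟩ ^ NumberField.classNumber K = 1 := pow_card_eq_one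
  rw [← map_pow] at h
  exact h

theorem exists_unit_of_fixed {A B : Type*} [CommRing A] [CommRing B] [Algebra A B] {σ : B ≃+* B}
    (hinj : Function.Injective (algebraMap A B))
    (hfix : ∀ x, σ x = x → ∃ a, algebraMap A B a = x) (u : Bˣ) (hu : σ u = u) :
    ∃ v : Aˣ, algebraMap A B v = u := by
  have hu' : σ (↑u⁻¹ : B) = ↑u⁻¹ := by
    have h : σ (↑u⁻¹ : B) * u = 1 := by
      calc σ (↑u⁻¹ : B) * u = σ (↑u⁻¹ : B) * σ u := by rw [hu]
        _ = 1 := by rw [← map_mul, Units.inv_mul, map_one]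
    exact Units.eq_inv_of_mul_eq_one_left (by rw [mul_comm, h])
  obtain ⟨a, ha⟩ := hfix _ hu
  obtain ⟨b, hb⟩ := hfix _ hu'
  have hab : a * b = 1 := hinj (by rw [map_mul, ha, hb, Units.mul_inv, map_one])
  exact ⟨⟨a, b, hab, by rw [mul_comm, hab]⟩, ha⟩

theorem fixed_of_norm_eq {B : Type*} [CommRing B] [IsDomain B] {σ : B ≃+* B}
    (hσ : ∀ x, σ (σ x) = x) {u x y : B} (hx : x ≠ 0) (h : y * σ y = u * (x * σ x)) :
    σ u = u := by
  have h' := congrArg σ h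
  simp only [map_mul, hσ] at h'
  have hx' : σ x ≠ 0 := by simpa using hx
  refine mul_right_cancel₀ (mul_ne_zero hx hx') ?_
  rw [← h, mul_comm y, h', mul_comm x]

/-! ### The quadratic field: odd class number and the splitting of 2 -/

section RealQuadratic

variable {k : Type*} [Field k] [NumberField k] {σ : 𝓞 k ≃+* 𝓞 k}

/-- For I invariant, the cofactor of I in the extension of I ∩ ℤ divides ω - σω = s. Since (s) is
prime, of norm p, the cofactor is (1) or (s), so I is principal. -/
theorem odd_classNumber_of_sq_eq_prime (hσ : ∀ x, σ (σ x) = x)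
    (hfix : ∀ x, σ x = x → ∃ n : ℤ, algebraMap ℤ (𝓞 k) n = x)
    (hdeg : Module.finrank ℚ k = 2) {p : ℕ} (hp : p.Prime) {s ω : 𝓞 k} (hs : s ^ 2 = p)
    (hω : 2 * ω = 1 + s) (hσs : σ s = -s) (ε : (𝓞 k)ˣ) (hε : (ε : 𝓞 k) * σ ε = -1) :
    Odd (NumberField.classNumber k) := by
  have hs0 : s ≠ 0 := by
    rintro rfl
    exact hp.ne_zero (by exact_mod_cast (by simpa using hs.symm : (p : 𝓞 k) = 0))
  have hσω : ω - σ ω = s := by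
    have h := congrArg σ hω
    simp only [map_mul, map_add, map_one, map_ofNat, hσs] at h
    refine mul_left_cancel₀ (two_ne_zero (α := 𝓞 k)) ?_
    linear_combination hω - h
  have hprime : (Ideal.span {s}).IsPrime := by
    refine Ideal.isPrime_of_irreducible_absNorm ?_
    have h : (Ideal.absNorm (Ideal.span {s})) ^ 2 = p ^ 2 := by
      rw [← map_pow, Ideal.span_singleton_pow, hs, Ideal.absNorm_span_natCast,
        NumberField.RingOfIntegers.rank, hdeg]
    rw [Nat.pow_left_injective two_ne_zero h]
    exact hp
  refine odd_card_classGroup hσ ⟨s, ?_⟩ ?_ ?_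
  · rw [hσs]
    intro h
    exact hs0 (self_eq_neg.mp h.symm)
  · intro I hI0 hI
    refine ⟨1, odd_one, ?_⟩
    rw [pow_one]
    have hle : (I.comap (algebraMap ℤ (𝓞 k))).map (algebraMap ℤ (𝓞 k)) ≤ I := Ideal.map_comap_le
    obtain ⟨A, hA⟩ := Ideal.dvd_iff_le.mpr hle
    have hsI : A ∣ Ideal.span {s} := by
      refine (mul_dvd_mul_iff_left hI0).mp ?_
      rw [← hA, Ideal.dvd_iff_le, mul_comm, Ideal.span_singleton_mul_le_iff]
      intro x hx
      rw [← hσω]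
      exact sub_mul_mem_map_comap hσ hfix hI ω hx
    have hJ : (I * A).IsPrincipal := by
      rw [← hA]
      obtain ⟨n, hn⟩ := IsPrincipalIdealRing.principal (I.comap (algebraMap ℤ (𝓞 k)))
      rw [hn]
      exact ⟨algebraMap ℤ (𝓞 k) n, by simp [Ideal.submodule_span_eq, Ideal.map_span]⟩
    have hs0' : Ideal.span {s} ≠ ⊥ := by simpa using hs0
    have hp' := (Ideal.prime_iff_isPrime hs0').mpr hprime
    have hA1 : A.IsPrincipal ∧ A ≠ ⊥ := by
      rcases (Prime.irreducible hp').dvd_iff.mp hsI with h | h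
      · rw [Ideal.isUnit_iff] at h
        rw [h]
        exact ⟨⟨1, by simp⟩, top_ne_bot⟩
      · rw [associated_iff_eq] at h
        rw [← h]
        exact ⟨⟨s, rfl⟩, hs0'⟩
    exact isPrincipal_of_mul_isPrincipal hI0 hA1.2 hJ hA1.1
  · intro u x y hx h
    obtain ⟨v, hv⟩ := exists_unit_of_fixed (FaithfulSMul.algebraMap_injective ℤ (𝓞 k)) hfix u
      (fixed_of_norm_eq hσ hx h)
    rcases Int.units_eq_one_or v with rfl | rfl
    · exact ⟨1, by simpa using hv⟩
    · exact ⟨ε, by rw [hε, ← hv]; simp⟩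

/-- If `2` splits and `ε` is a unit of norm `-1`, then `ε` is a square modulo `4` at exactly one
of the two primes above `2`. -/
theorem exists_split_two
    (hdeg : Module.finrank ℚ k = 2) {ω m : 𝓞 k} (hω : ω ^ 2 = ω + 2 * m) (hσω : σ ω = 1 - ω)
    (ε : (𝓞 k)ˣ) (hε : (ε : 𝓞 k) * σ ε = -1) :
    ∃ q q' : Ideal (𝓞 k), q * q' = Ideal.span {2} ∧ Ideal.absNorm q = 2 ∧
      (ε : 𝓞 k) - 1 ∈ q' ^ 2 ∧ (ε : 𝓞 k) + 1 ∈ q ^ 2 ∧ (ε : 𝓞 k) - 1 ∉ q ^ 2 := by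
  set q₁ : Ideal (𝓞 k) := Ideal.span {2, ω} with hq₁
  set q₂ : Ideal (𝓞 k) := Ideal.span {2, 1 - ω} with hq₂
  have hmap₁ : q₁.map σ = q₂ := by
    rw [hq₁, hq₂, Ideal.map_span, Set.image_pair, hσω, map_ofNat]
  have hmul : q₁ * q₂ = Ideal.span {2} := by
    refine le_antisymm ?_ ?_
    · rw [hq₁, hq₂, Ideal.span_pair_mul_span_pair, Ideal.span_le]
      intro x hx
      simp only [Set.mem_insert_iff, Set.mem_singleton_iff] at hx
      rw [SetLike.mem_coe, Ideal.mem_span_singleton]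
      rcases hx with rfl | rfl | rfl | rfl
      · exact ⟨2, rfl⟩
      · exact ⟨_, rfl⟩
      · exact ⟨_, mul_comm _ _⟩
      · exact ⟨-m, by linear_combination -hω⟩
    · rw [Ideal.span_singleton_le_iff_mem]
      have h1 : (2 : 𝓞 k) * (1 - ω) ∈ q₁ * q₂ :=
        Ideal.mul_mem_mul (Ideal.subset_span (by simp)) (Ideal.subset_span (by simp))
      have h2 : ω * 2 ∈ q₁ * q₂ :=
        Ideal.mul_mem_mul (Ideal.subset_span (by simp)) (Ideal.subset_span (by simp))
      convert Ideal.add_mem _ h1 h2 using 1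
      ring
  have hcop : IsCoprime q₁ q₂ := by
    rw [Ideal.isCoprime_iff_exists]
    exact ⟨ω, Ideal.subset_span (by simp), 1 - ω, Ideal.subset_span (by simp), by ring⟩
  have hnorm_eq : Ideal.absNorm q₁ = Ideal.absNorm q₂ := by
    rw [Ideal.absNorm_apply, Ideal.absNorm_apply, Submodule.cardQuot_apply,
      Submodule.cardQuot_apply]
    exact Nat.card_congr (Ideal.quotientEquiv q₁ q₂ σ hmap₁.symm).toEquiv
  have hnorm₁ : Ideal.absNorm q₁ = 2 := by
    refine Nat.pow_left_injective two_ne_zero ?_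
    have h := congrArg Ideal.absNorm hmul
    rw [map_mul, ← hnorm_eq, ← sq] at h
    simp only [h]
    have h' := Ideal.absNorm_span_natCast (S := 𝓞 k) 2
    rwa [NumberField.RingOfIntegers.rank, hdeg, Nat.cast_ofNat] at h'
  have hnorm₂ : Ideal.absNorm q₂ = 2 := hnorm_eq ▸ hnorm₁
  have hprime₁ : q₁.IsPrime :=
    Ideal.isPrime_of_irreducible_absNorm (by rw [hnorm₁]; exact Nat.prime_two)
  have hq₁2 : ((2 : 𝓞 k)) ∈ q₁ := Ideal.subset_span (by simp)
  have hdich : ∀ x, x ∈ q₁ ∨ x - 1 ∈ q₁ := by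
    intro x
    by_contra! hcon
    have hcard : Nat.card (𝓞 k ⧸ q₁) = 2 := by
      rw [← hnorm₁, Ideal.absNorm_apply, Submodule.cardQuot_apply]
    obtain ⟨a, b, -, hab⟩ := Nat.card_eq_two_iff.mp hcard
    have hz : ∀ z : 𝓞 k ⧸ q₁, z = a ∨ z = b := fun z ↦ by
      simpa using (hab ▸ Set.mem_univ z : z ∈ ({a, b} : Set _))
    have h1 : Ideal.Quotient.mk q₁ x ≠ 0 := fun h ↦ hcon.1 (Ideal.Quotient.eq_zero_iff_mem.mp h)
    have h2 : Ideal.Quotient.mk q₁ x ≠ 1 := fun h ↦ hcon.2 (Ideal.Quotient.eq.mp (by simpa using h))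
    have h3 : (0 : 𝓞 k ⧸ q₁) ≠ 1 := zero_ne_one
    rcases hz 0 with h | h <;> rcases hz 1 with h' | h' <;>
      rcases hz (Ideal.Quotient.mk q₁ x) with h'' | h'' <;> simp_all
  have hωsq : ω + 2 * m ∈ q₁ ^ 2 := by
    rw [← hω]
    exact Ideal.pow_mem_pow (Ideal.subset_span (by simp)) 2
  have h4 : (4 : 𝓞 k) ∈ q₁ ^ 2 := by
    have := Ideal.pow_mem_pow hq₁2 2
    norm_num at this
    exact this
  have hε1 : (ε : 𝓞 k) - 1 ∈ q₁ := by
    rcases hdich ε with h | h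
    · exact absurd (Ideal.eq_top_of_isUnit_mem _ h ε.isUnit) hprime₁.ne_top
    · exact h
  -- Write ε - 1 = 2a + bω. Modulo q₁², ω ≡ -2m, so ε - 1 ≡ 2(a - mb), which is 0 or 2 because the
  -- residue field has two elements.
  have hεsq : (ε : 𝓞 k) - 1 ∈ q₁ ^ 2 ∨ (ε : 𝓞 k) + 1 ∈ q₁ ^ 2 := by
    obtain ⟨a, b, hab⟩ := Ideal.mem_span_pair.mp hε1
    have hc : (ε : 𝓞 k) - 1 - 2 * (a - m * b) ∈ q₁ ^ 2 := by
      convert Ideal.mul_mem_left _ b hωsq using 1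
      rw [← hab]; ring
    have h2q : ∀ x ∈ q₁, 2 * x ∈ q₁ ^ 2 := fun x hx ↦ by
      rw [sq]; exact Ideal.mul_mem_mul hq₁2 hx
    rcases hdich (a - m * b) with h | h
    · left
      convert Ideal.add_mem _ hc (h2q _ h) using 1
      ring
    · right
      convert Ideal.add_mem _ (Ideal.add_mem _ hc (h2q _ h)) h4 using 1
      ring
  have h2 : ∀ q q' : Ideal (𝓞 k), IsCoprime q q' → q * q' = Ideal.span {2} →
      Ideal.absNorm q = 2 → (2 : 𝓞 k) ∉ q ^ 2 := by
    intro q q' hc hqq hN h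
    rw [← Ideal.span_singleton_le_iff_mem, ← hqq, ← Ideal.dvd_iff_le, sq] at h
    have hq0 : q ≠ 0 := by
      rintro rfl
      simp at hN
    have hu := hc.isUnit_of_dvd' dvd_rfl ((mul_dvd_mul_iff_left hq0).mp h)
    rw [Ideal.isUnit_iff] at hu
    rw [hu] at hN
    simp at hN
  -- Since σε = -ε⁻¹, conjugation turns ε ≡ ±1 mod q₁² into ε ≡ ∓1 mod q₂².
  have hconj : ∀ x ∈ q₁ ^ 2, σ x ∈ q₂ ^ 2 := by
    intro x hx
    rw [← hmap₁, ← Ideal.map_pow]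
    exact Ideal.mem_map_of_mem _ hx
  rcases hεsq with h | h
  · have h' : (ε : 𝓞 k) + 1 ∈ q₂ ^ 2 := by
      have := Ideal.mul_mem_left _ (-(ε : 𝓞 k)) (hconj _ h)
      convert this using 1
      rw [map_sub, map_one]
      linear_combination hε
    refine ⟨q₂, q₁, by rw [mul_comm, hmul], hnorm₂, h, h', fun h'' ↦ ?_⟩
    refine h2 q₂ q₁ hcop.symm (by rw [mul_comm, hmul]) hnorm₂ ?_
    convert Ideal.sub_mem _ h' h'' using 1
    ring
  · have h' : (ε : 𝓞 k) - 1 ∈ q₂ ^ 2 := by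
      have := Ideal.mul_mem_left _ (ε : 𝓞 k) (hconj _ h)
      convert this using 1
      rw [map_add, map_one]
      linear_combination -hε
    refine ⟨q₁, q₂, hmul, hnorm₁, h', h, fun h'' ↦ ?_⟩
    refine h2 q₁ q₂ hcop hmul hnorm₁ ?_
    convert Ideal.sub_mem _ h h'' using 1
    ring

end RealQuadratic

/-! ### The extension k(√ε): ramification above 2 and the class of the ramified prime -/

section SqrtUnit

variable {k L : Type*} [Field k] [Field L] [NumberField L] [Algebra k L]
  {σ : 𝓞 L ≃+* 𝓞 L}

/-- The prime `q` of `k` with `ε ≡ -1` but not `ε ≡ 1` modulo `q²` ramifies in `k(√ε)`. -/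
theorem exists_sq_eq_map [NumberField k] (hdeg : Module.finrank k L = 2)
    {q : Ideal (𝓞 k)} (hq : Ideal.absNorm q = 2) (hq2 : (2 : 𝓞 k) ∈ q) {ε : 𝓞 k}
    (hε₁ : ε + 1 ∈ q ^ 2) (hε₂ : ε - 1 ∉ q ^ 2) {t : 𝓞 L}
    (ht : t ^ 2 = algebraMap (𝓞 k) (𝓞 L) ε) :
    ∃ P : Ideal (𝓞 L), Prime P ∧ P ^ 2 = q.map (algebraMap (𝓞 k) (𝓞 L)) := by
  set f := algebraMap (𝓞 k) (𝓞 L)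
  have hqprime : q.IsPrime :=
    Ideal.isPrime_of_irreducible_absNorm (by rw [hq]; exact Nat.prime_two)
  have hq0 : q ≠ ⊥ := by
    rintro rfl
    simp at hq
  have hε₃ : 1 - ε ∈ q := by
    have h := Ideal.sub_mem _ hq2 (Ideal.pow_le_self two_ne_zero hε₁)
    convert h using 1
    ring
  have hsup : q ^ 2 ⊔ Ideal.span {1 - ε} = q := by
    refine le_antisymm (sup_le (Ideal.pow_le_self two_ne_zero)
      ((Ideal.span_singleton_le_iff_mem _).mpr hε₃)) ?_
    have hd : q ^ 2 ⊔ Ideal.span {1 - ε} ∣ q ^ 2 := Ideal.dvd_iff_le.mpr le_sup_left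
    obtain ⟨i, hi, he⟩ := (dvd_prime_pow ((Ideal.prime_iff_isPrime hq0).mpr hqprime) _).mp hd
    rw [associated_iff_eq] at he
    have hi2 : i ≠ 2 := by
      rintro rfl
      apply hε₂
      rw [← neg_mem_iff, neg_sub, ← he]
      exact Ideal.mem_sup_right (Ideal.mem_span_singleton_self _)
    rw [he]
    interval_cases i
    · simp
    · simp
    · exact absurd rfl hi2
  -- P² = q follows from (1 + t)² = 2(1 + t) - (1 - ε) in one direction, and in the other from 1 - ε
  -- = (1 + t)(1 - t), as q is generated by q² and 1 - ε.
  set P : Ideal (𝓞 L) := q.map f ⊔ Ideal.span {1 + t} with hP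
  have hqP : q.map f ≤ P := le_sup_left
  have htP : 1 + t ∈ P := Ideal.mem_sup_right (Ideal.mem_span_singleton_self _)
  have hsq : P ^ 2 = q.map f := by
    refine le_antisymm ?_ ?_
    · rw [sq, hP, Ideal.sup_mul, Ideal.mul_sup, Ideal.mul_sup]
      refine sup_le (sup_le Ideal.mul_le_right Ideal.mul_le_left)
        (sup_le Ideal.mul_le_right ?_)
      rw [Ideal.span_singleton_mul_span_singleton, Ideal.span_singleton_le_iff_mem]
      have h1 := Ideal.mul_mem_right (1 + t) _ (Ideal.mem_map_of_mem f hq2)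
      have h2 := Ideal.mem_map_of_mem f hε₃
      convert Ideal.sub_mem _ h1 h2 using 1
      simp only [map_sub, map_one, map_ofNat, ← ht]
      ring
    · conv_lhs => rw [← hsup]
      rw [Ideal.map_sup, Ideal.map_pow, Ideal.map_span, Set.image_singleton]
      refine sup_le (Ideal.pow_right_mono hqP 2) ?_
      rw [Ideal.span_singleton_le_iff_mem]
      have h1 : 1 - t ∈ P := by
        have h := Ideal.sub_mem _ (hqP (Ideal.mem_map_of_mem f hq2)) htP
        convert h using 1
        rw [map_ofNat]; ring
      have h2 : f (1 - ε) = (1 + t) * (1 - t) := by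
        rw [map_sub, map_one, ← ht]; ring
      rw [h2, sq]
      exact Ideal.mul_mem_mul htP h1
  refine ⟨P, ?_, hsq⟩
  have hnorm : Ideal.absNorm P = 2 := by
    refine Nat.pow_left_injective two_ne_zero ?_
    simp only
    rw [← map_pow, hsq, Ideal.absNorm_algebraMap, hq]
    congr 1
    rw [← hdeg]
    exact (IsFractionRing.finrank_eq (𝓞 k) k (𝓞 L) L).symm
  have hP0 : P ≠ ⊥ := by
    intro h
    rw [h] at hnorm
    simp at hnorm
  exact (Ideal.prime_iff_isPrime hP0).mpr
    (Ideal.isPrime_of_irreducible_absNorm (by rw [hnorm]; exact Nat.prime_two))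

/-- For c in q², c²(ε - 1) is divisible by 4, so θ = c(1 + t)/2 is integral. As θ - σθ = ct with t a
unit, c multiplies I into the extension of I ∩ k, so only P can occur in the cofactor. -/
theorem exists_map_comap_eq_mul_pow (hσ : ∀ x, σ (σ x) = x)
    (hfix : ∀ x, σ x = x → ∃ a, algebraMap (𝓞 k) (𝓞 L) a = x)
    (hσk : ∀ a, σ (algebraMap (𝓞 k) (𝓞 L) a) = algebraMap (𝓞 k) (𝓞 L) a)
    {q q' : Ideal (𝓞 k)} (hqq : q * q' = Ideal.span {2}) {ε : (𝓞 k)ˣ}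
    (hε : (ε : 𝓞 k) - 1 ∈ q' ^ 2) {t : (𝓞 L)ˣ} (ht : (t : 𝓞 L) ^ 2 = algebraMap (𝓞 k) (𝓞 L) ε)
    (hσt : σ t = -t) {P : Ideal (𝓞 L)} (hP : Prime P)
    (hPq : P ^ 2 = q.map (algebraMap (𝓞 k) (𝓞 L))) {I : Ideal (𝓞 L)} (hI0 : I ≠ ⊥)
    (hI : I.map σ = I) :
    ∃ i : ℕ, (I.comap (algebraMap (𝓞 k) (𝓞 L))).map (algebraMap (𝓞 k) (𝓞 L)) = I * P ^ i := by
  set f := algebraMap (𝓞 k) (𝓞 L)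
  have hle : (I.comap f).map f ≤ I := Ideal.map_comap_le
  obtain ⟨A, hA⟩ := Ideal.dvd_iff_le.mpr hle
  -- The exponent 4 comes from q² = P⁴ and is not sharp; any power of P would do.
  suffices hd : A ∣ P ^ 4 by
    obtain ⟨i, -, hi⟩ := (dvd_prime_pow hP _).mp hd
    rw [associated_iff_eq] at hi
    exact ⟨i, by rw [hA, hi]⟩
  refine (mul_dvd_mul_iff_left hI0).mp ?_
  rw [← hA, Ideal.dvd_iff_le, show 4 = 2 * 2 from rfl, pow_mul, hPq, ← Ideal.map_pow, mul_comm,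
    Ideal.mul_le]
  suffices h : ∀ c ∈ q ^ 2, ∀ x ∈ I, f c * x ∈ (I.comap f).map f by
    intro r hr x hx
    induction hr using Submodule.span_induction with
    | mem y hy =>
      obtain ⟨c, hc, rfl⟩ := hy
      exact h c hc x hx
    | zero => simp
    | add y z _ _ hy hz => rw [add_mul]; exact Ideal.add_mem _ hy hz
    | smul a y _ hy => rw [smul_eq_mul, mul_assoc]; exact Ideal.mul_mem_left _ _ hy
  intro c hc x hx
  obtain ⟨d, hd⟩ : ∃ d, c ^ 2 * (ε - 1) = 4 * d := by
    have h1 : c ^ 2 * ((ε : 𝓞 k) - 1) ∈ (q ^ 2) * (q' ^ 2) := by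
      rw [sq c, mul_assoc]
      exact Ideal.mul_mem_mul hc (Ideal.mul_mem_left _ _ hε)
    rw [← mul_pow, hqq, Ideal.span_singleton_pow, Ideal.mem_span_singleton] at h1
    obtain ⟨d, hd⟩ := h1
    exact ⟨d, by rw [hd]; norm_num⟩
  obtain ⟨θ, hθ⟩ : ∃ θ : 𝓞 L, 2 * θ = f c * (1 + t) := by
    have hint : IsIntegral (𝓞 k) (((f c * (1 + t) : 𝓞 L) : L) / 2) := by
      -- θ has trace c and norm c²(1 - ε)/4 = -d.
      refine ⟨Polynomial.X ^ 2 - (Polynomial.C c * Polynomial.X + Polynomial.C d), ?_, ?_⟩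
      · refine Polynomial.monic_X_pow_sub ?_
        refine Polynomial.degree_linear_le.trans_lt ?_
        norm_num
      · have h1 : (f c) ^ 2 * ((t : 𝓞 L) ^ 2 - 1) = 4 * f d := by
          rw [ht, ← map_one f, ← map_sub, ← map_pow, ← map_mul, hd, map_mul, map_ofNat]
        have h2 := congrArg (algebraMap (𝓞 L) L) h1
        simp only [map_mul, map_pow, map_sub, map_one, map_ofNat] at h2
        have hfL : ∀ a, algebraMap (𝓞 k) L a = algebraMap (𝓞 L) L (f a) := fun a ↦
          IsScalarTower.algebraMap_apply (𝓞 k) (𝓞 L) L a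
        simp only [Polynomial.eval₂_sub, Polynomial.eval₂_add, Polynomial.eval₂_mul,
          Polynomial.eval₂_pow, Polynomial.eval₂_X, Polynomial.eval₂_C, hfL, map_mul, map_add,
          map_one]
        linear_combination h2 / 4
    have hint' : IsIntegral ℤ (((f c * (1 + t) : 𝓞 L) : L) / 2) := isIntegral_trans _ hint
    refine ⟨⟨_, hint'⟩, ?_⟩
    exact NumberField.RingOfIntegers.ext (mul_div_cancel₀ _ two_ne_zero)
  have hθσ : θ - σ θ = f c * t := by
    have h := congrArg σ hθ
    simp only [map_mul, map_add, map_one, map_ofNat, hσt, hσk, f] at h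
    refine mul_left_cancel₀ (two_ne_zero (α := 𝓞 L)) ?_
    linear_combination hθ - h
  have h := Ideal.mul_mem_left _ (↑t⁻¹ : 𝓞 L) (sub_mul_mem_map_comap hσ hfix hI θ hx)
  rw [hθσ] at h
  convert h using 1
  linear_combination -(f c * x) * t.inv_mul

theorem exists_sq_of_odd_pow {G : Type*} [CommGroup G] [HasDistribNeg G] (s : G →* G) {η z : G}
    (hη : η * s η = 1) (hz : z * s z = 1) {n : ℕ}
    (h : η ^ (2 * n + 1) = z ^ 2 ∨ η ^ (2 * n + 1) = -z ^ 2) :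
    ∃ v, v * s v = 1 ∧ (η = v ^ 2 ∨ η = -v ^ 2) := by
  have hη' : η = η ^ (2 * n + 1) * ((η ^ n)⁻¹) ^ 2 := by
    rw [inv_pow, ← pow_mul, mul_comm n, pow_succ', mul_inv_cancel_right]
  refine ⟨z * (η ^ n)⁻¹, ?_, ?_⟩
  · rw [map_mul, mul_mul_mul_comm, hz, map_inv, map_pow, ← mul_inv, ← mul_pow, hη]
    simp
  · rw [mul_pow]
    rcases h with h | h
    · left; rwa [h] at hη'
    · right; rwa [h, neg_mul] at hη'

/-- If `η` is a unit of norm one, none of whose associates `±η` is the square of a unit of norm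
one, then the class of the ramified prime of `k(√ε)` has odd order. -/
theorem exists_odd_isPrincipal_pow [NumberField k] (hσ : ∀ x, σ (σ x) = x)
    (hfix : ∀ x, σ x = x → ∃ a, algebraMap (𝓞 k) (𝓞 L) a = x)
    (hσk : ∀ a, σ (algebraMap (𝓞 k) (𝓞 L) a) = algebraMap (𝓞 k) (𝓞 L) a)
    (hk : Odd (NumberField.classNumber k)) {q : Ideal (𝓞 k)} {ε : (𝓞 k)ˣ}
    {t : (𝓞 L)ˣ} (ht : (t : 𝓞 L) ^ 2 = algebraMap (𝓞 k) (𝓞 L) ε) (hσt : σ t = -t)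
    (hunit : ∀ (u : (𝓞 k)ˣ) (x y : 𝓞 L), x ≠ 0 →
      y * σ y = algebraMap (𝓞 k) (𝓞 L) u * (x * σ x) → ∃ v : (𝓞 k)ˣ, u = v ^ 2 ∨ u = -ε * v ^ 2)
    {η : (𝓞 L)ˣ} (hη : (η : 𝓞 L) * σ η = 1)
    (hη' : ∀ v : (𝓞 L)ˣ, (v : 𝓞 L) * σ v = 1 → η ≠ v ^ 2 ∧ η ≠ -v ^ 2)
    {P : Ideal (𝓞 L)} (hP0 : P ≠ ⊥) (hPq : P ^ 2 = q.map (algebraMap (𝓞 k) (𝓞 L)))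
    (hinv : ∀ I : Ideal (𝓞 L), I ≠ ⊥ → I.map σ = I → ∃ i : ℕ,
      (I.comap (algebraMap (𝓞 k) (𝓞 L))).map (algebraMap (𝓞 k) (𝓞 L)) = I * P ^ i) :
    ∃ m, Odd m ∧ (P ^ m).IsPrincipal := by
  set f := algebraMap (𝓞 k) (𝓞 L)
  have hfinj : Function.Injective f := FaithfulSMul.algebraMap_injective _ _
  have hne : ∃ s, σ s ≠ s := ⟨t, by
    rw [hσt]
    intro h
    exact t.ne_zero (self_eq_neg.mp h.symm)⟩
  obtain ⟨b, hb0, hb⟩ := exists_mul_eq_mul_of_norm_eq hσ hne (x := 1) (y := (η : 𝓞 L)) one_ne_zero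
    (by rw [hη, map_one, one_mul])
  rw [one_mul] at hb
  have hbs : Ideal.span {b} ≠ ⊥ := by simpa using hb0
  have hbσ : (Ideal.span {b}).map σ = Ideal.span {b} := by
    rw [Ideal.map_span, Set.image_singleton, Ideal.span_singleton_eq_span_singleton]
    exact ⟨η, hb⟩
  obtain ⟨i, hi⟩ := hinv _ hbs hbσ
  set J := (Ideal.span {b}).comap f
  have hJ0 : J ≠ ⊥ := by
    rintro h
    rw [h, Ideal.map_bot] at hi
    exact mul_ne_zero hbs (pow_ne_zero i hP0) hi.symm
  set h := NumberField.classNumber k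
  obtain ⟨a, ha⟩ := NumberField.isPrincipal_pow_classNumber J hJ0
  rw [Ideal.submodule_span_eq] at ha
  -- For i = 2j, the h-th power of (b)Pⁱ = J gives f(a)w = bʰ f(c)ʲ with w a unit. Dividing by the
  -- conjugate equation, ηʰ = w/σ(w) = w²/N(w).
  rcases Nat.even_or_odd i with hi2 | hi2
  · exfalso
    obtain ⟨j, hj⟩ := hi2
    have hq0 : q ≠ ⊥ := by
      rintro rfl
      rw [Ideal.map_bot] at hPq
      exact pow_ne_zero 2 hP0 hPq
    obtain ⟨c, hc⟩ := NumberField.isPrincipal_pow_classNumber q hq0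
    rw [Ideal.submodule_span_eq] at hc
    have hideal : Ideal.span {f a} = Ideal.span {b ^ h * f c ^ j} := by
      have e1 : (J.map f) ^ h = Ideal.span {f a} := by
        rw [← Ideal.map_pow, ha, Ideal.map_span, Set.image_singleton]
      have e2 : (q.map f) ^ h = Ideal.span {f c} := by
        rw [← Ideal.map_pow, hc, Ideal.map_span, Set.image_singleton]
      rw [← e1, hi, hj, ← two_mul, pow_mul, hPq, mul_pow, ← pow_mul, mul_comm j, pow_mul, e2,
        Ideal.span_singleton_pow, Ideal.span_singleton_pow,
        Ideal.span_singleton_mul_span_singleton]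
    obtain ⟨w, hw⟩ := Ideal.span_singleton_eq_span_singleton.mp hideal
    have hw' := congrArg σ hw
    simp only [map_mul, map_pow, hσk] at hw'
    have hb' : b ^ h = σ b ^ h * (η : 𝓞 L) ^ h := by rw [← mul_pow, hb]
    have hfa : f a ≠ 0 := by
      intro h0
      have : a = 0 := hfinj (by rw [h0, map_zero])
      rw [this] at ha
      exact pow_ne_zero h hJ0 (by simpa using ha)
    have hση : (σ w : 𝓞 L) * η ^ h = w := by
      have h1 : f c ^ j * σ b ^ h ≠ 0 := by
        intro h0
        have h2 : b ^ h * f c ^ j = 0 := by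
          rw [hb']
          linear_combination η ^ h * h0
        rw [← hw] at h2
        exact mul_ne_zero hfa w.ne_zero h2
      refine mul_left_cancel₀ hfa ?_
      rw [hw, hb']
      linear_combination η ^ h * hw'
    have hwfix : σ ((w : 𝓞 L) * σ w) = w * σ w := by rw [map_mul, hσ, mul_comm]
    obtain ⟨u, hu⟩ := exists_unit_of_fixed hfinj hfix
      (w * Units.map (σ : 𝓞 L →* 𝓞 L) w) (by simpa using hwfix)
    set S : (𝓞 L)ˣ →* (𝓞 L)ˣ := Units.map (σ : 𝓞 L →* 𝓞 L)
    set V : (𝓞 k)ˣ →* (𝓞 L)ˣ := Units.map f.toMonoidHom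
    have hSV : ∀ v, S (V v) = V v := fun v ↦ Units.ext (hσk v)
    have hwV : w * S w = V u := Units.ext hu.symm
    have hSη : η * S η = 1 := Units.ext hη
    have hSw : S w * η ^ h = w := Units.ext hση
    have hηh : η ^ h = w ^ 2 * (V u)⁻¹ := by
      rw [← hwV, mul_inv, sq, mul_assoc, mul_inv_cancel_left, ← div_eq_mul_inv]
      exact eq_div_of_mul_eq'' hSw
    have hSt : S t = -t := Units.ext hσt
    have htV : V ε = t ^ 2 := Units.ext ht.symm
    obtain ⟨n, hn⟩ := hk
    rw [hn] at hηh
    suffices hz : ∃ z, z * S z = 1 ∧ (η ^ (2 * n + 1) = z ^ 2 ∨ η ^ (2 * n + 1) = -z ^ 2) by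
      obtain ⟨z, hz, hzη⟩ := hz
      obtain ⟨v, hv, hvη⟩ := exists_sq_of_odd_pow S hSη hz hzη
      have := hη' v (congrArg Units.val hv)
      tauto
    -- N(w) = v² or -εv² = -(tv)², so ηʰ = ±z² with z = w/v or w/(tv), and z has relative norm one.
    obtain ⟨v, rfl | rfl⟩ := hunit u 1 w one_ne_zero
      (by rw [map_one, mul_one, mul_one]; exact hu.symm)
    · refine ⟨w * (V v)⁻¹, ?_, Or.inl ?_⟩
      · rw [map_mul, map_inv, hSV, mul_mul_mul_comm, hwV, map_pow, sq]
        group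
      · rw [hηh, mul_pow, inv_pow, map_pow]
    · have hVu : V (-ε * v ^ 2) = -(t * V v) ^ 2 := by
        rw [mul_pow, ← htV, ← map_pow, ← map_mul]
        exact Units.ext (by simp [V])
      rw [hVu] at hηh hwV
      refine ⟨w * (t * V v)⁻¹, ?_, Or.inr ?_⟩
      · rw [map_mul, map_inv, map_mul, hSV, hSt, mul_mul_mul_comm, hwV, neg_mul t, inv_neg, mul_neg,
          mul_neg, neg_mul, neg_neg, sq, ← mul_inv, mul_inv_cancel]
      · rw [hηh, inv_neg, mul_neg, mul_pow w, inv_pow]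
  · refine ⟨i * h, hi2.mul hk, ?_⟩
    refine isPrincipal_of_mul_isPrincipal (J := Ideal.span {b} ^ h) (pow_ne_zero _ hP0)
      (pow_ne_zero _ hbs) ⟨f a, ?_⟩
      (Ideal.isPrincipal_pow (I := Ideal.span {b}) ⟨b, rfl⟩ _)
    rw [Ideal.submodule_span_eq, pow_mul, mul_comm, ← mul_pow, ← hi, ← Ideal.map_pow, ha,
      Ideal.map_span, Set.image_singleton]

/-- If IPⁱ comes from k and Pᵐ is principal with m odd, raising to the odd power hm makes I
principal. The units v² and -εv² are the norms of v and tv. -/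
theorem odd_classNumber_sqrt_unit [NumberField k] (hσ : ∀ x, σ (σ x) = x)
    (hfix : ∀ x, σ x = x → ∃ a, algebraMap (𝓞 k) (𝓞 L) a = x)
    (hσk : ∀ a, σ (algebraMap (𝓞 k) (𝓞 L) a) = algebraMap (𝓞 k) (𝓞 L) a)
    (hdeg : Module.finrank k L = 2) (hk : Odd (NumberField.classNumber k))
    {q q' : Ideal (𝓞 k)} (hqq : q * q' = Ideal.span {2}) (hq : Ideal.absNorm q = 2) {ε : (𝓞 k)ˣ}
    (hε : (ε : 𝓞 k) - 1 ∈ q' ^ 2) (hε₁ : (ε : 𝓞 k) + 1 ∈ q ^ 2) (hε₂ : (ε : 𝓞 k) - 1 ∉ q ^ 2)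
    {t : (𝓞 L)ˣ} (ht : (t : 𝓞 L) ^ 2 = algebraMap (𝓞 k) (𝓞 L) ε) (hσt : σ t = -t)
    (hunit : ∀ (u : (𝓞 k)ˣ) (x y : 𝓞 L), x ≠ 0 →
      y * σ y = algebraMap (𝓞 k) (𝓞 L) u * (x * σ x) → ∃ v : (𝓞 k)ˣ, u = v ^ 2 ∨ u = -ε * v ^ 2)
    {η : (𝓞 L)ˣ} (hη : (η : 𝓞 L) * σ η = 1)
    (hη' : ∀ v : (𝓞 L)ˣ, (v : 𝓞 L) * σ v = 1 → η ≠ v ^ 2 ∧ η ≠ -v ^ 2) :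
    Odd (NumberField.classNumber L) := by
  have hq2 : (2 : 𝓞 k) ∈ q :=
    (Ideal.span_singleton_le_iff_mem q).mp (hqq ▸ Ideal.mul_le_left)
  obtain ⟨P, hP, hPq⟩ := exists_sq_eq_map hdeg hq hq2 hε₁ hε₂ ht
  have hinv := fun (I : Ideal (𝓞 L)) (hI0 : I ≠ ⊥) (hI : I.map σ = I) ↦
    exists_map_comap_eq_mul_pow hσ hfix hσk hqq hε ht hσt hP hPq hI0 hI
  obtain ⟨m, hm, hPm⟩ := exists_odd_isPrincipal_pow hσ hfix hσk hk ht hσt hunit hη hη' hP.ne_zero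
    hPq hinv
  refine odd_card_classGroup hσ ⟨t, ?_⟩ ?_ ?_
  · rw [hσt]
    intro h
    exact t.ne_zero (self_eq_neg.mp h.symm)
  · intro I hI0 hI
    obtain ⟨i, hi⟩ := hinv I hI0 hI
    set J := I.comap (algebraMap (𝓞 k) (𝓞 L))
    have hJ0 : J ≠ ⊥ := by
      rintro h
      rw [h, Ideal.map_bot] at hi
      exact mul_ne_zero hI0 (pow_ne_zero i hP.ne_zero) hi.symm
    obtain ⟨a, ha⟩ := NumberField.isPrincipal_pow_classNumber J hJ0
    rw [Ideal.submodule_span_eq] at ha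
    refine ⟨NumberField.classNumber k * m, hk.mul hm, ?_⟩
    refine isPrincipal_of_mul_isPrincipal (J := (P ^ i) ^ (NumberField.classNumber k * m))
      (pow_ne_zero _ hI0) (pow_ne_zero _ (pow_ne_zero _ hP.ne_zero)) ?_ ?_
    · rw [← mul_pow, ← hi, pow_mul, ← Ideal.map_pow, ha, Ideal.map_span, Set.image_singleton]
      exact Ideal.isPrincipal_pow (I := Ideal.span {algebraMap (𝓞 k) (𝓞 L) a}) ⟨_, rfl⟩ _
    · rw [← pow_mul, ← mul_assoc, mul_comm, pow_mul]
      exact Ideal.isPrincipal_pow hPm _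
  · intro u x y hx h
    obtain ⟨u₀, hu₀⟩ := exists_unit_of_fixed (FaithfulSMul.algebraMap_injective _ _) hfix u
      (fixed_of_norm_eq hσ hx h)
    obtain ⟨v, hv | hv⟩ := hunit u₀ x y hx (by rw [hu₀, h])
    · refine ⟨Units.map (algebraMap (𝓞 k) (𝓞 L)).toMonoidHom v, ?_⟩
      rw [← hu₀, hv]
      simp [hσk, sq]
    · refine ⟨t * Units.map (algebraMap (𝓞 k) (𝓞 L)).toMonoidHom v, ?_⟩
      rw [← hu₀, hv]
      simp [hσk, hσt, ← ht]
      ring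

end SqrtUnit

/-! ### Real embeddings and unit ranks -/

section RealPlaces

open NumberField NumberField.InfinitePlace

variable {K : Type*} [Field K] [NumberField K]

theorem nrRealPlaces_pos_of_real (φ : K →+* ℝ) : 0 < nrRealPlaces K := by
  classical
  exact Fintype.card_pos_iff.mpr ⟨mkReal ⟨Complex.ofRealHom.comp φ, by ext x; simp⟩⟩

theorem one_lt_nrRealPlaces_of_real {φ ψ : K →+* ℝ} (h : φ ≠ ψ) : 1 < nrRealPlaces K := by
  classical
  refine Fintype.one_lt_card_iff.mpr ⟨mkReal ⟨Complex.ofRealHom.comp φ, by ext x; simp⟩,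
    mkReal ⟨Complex.ofRealHom.comp ψ, by ext x; simp⟩, mkReal.injective.ne fun h' ↦ h ?_⟩
  ext x
  have := congrArg (fun f ↦ f.1 x) h'
  simpa using this

theorem rank_eq_one_of_real (φ : K →+* ℝ) (h : Module.finrank ℚ K = 2) : Units.rank K = 1 := by
  have h1 := nrRealPlaces_pos_of_real φ
  have h2 := card_add_two_mul_card_eq_rank K
  rw [Units.rank, card_eq_nrRealPlaces_add_nrComplexPlaces]
  omega

theorem one_lt_rank_of_real {φ ψ : K →+* ℝ} (hne : φ ≠ ψ) (h : Module.finrank ℚ K = 4) :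
    1 < Units.rank K := by
  have h1 := one_lt_nrRealPlaces_of_real hne
  have h2 := card_add_two_mul_card_eq_rank K
  rw [Units.rank, card_eq_nrRealPlaces_add_nrComplexPlaces]
  omega

theorem eq_one_or_neg_one_of_mem_torsion (φ : K →+* ℝ) {ζ : (𝓞 K)ˣ} (h : ζ ∈ Units.torsion K) :
    ζ = 1 ∨ ζ = -1 := by
  obtain ⟨n, hn, h⟩ := (isOfFinOrder_iff_pow_eq_one.mp h)
  have h' : φ (ζ : K) ^ n = 1 := by
    rw [← map_pow, ← Units.coe_pow, h]
    simp
  have h'' : φ (ζ : K) = 1 ∨ φ (ζ : K) = -1 := by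
    have : |φ (ζ : K)| = 1 := by
      rw [← pow_eq_one_iff_of_nonneg (abs_nonneg _) hn.ne', ← abs_pow, h', abs_one]
    exact eq_or_eq_neg_of_abs_eq this
  rcases h'' with h | h
  · left
    apply Units.coe_injective K
    exact φ.injective (by simp [h])
  · right
    apply Units.coe_injective K
    exact φ.injective (by simp [h])

theorem exists_fundamental_unit (φ : K →+* ℝ) (h : Units.rank K = 1) :
    ∃ e : (𝓞 K)ˣ, ∀ u : (𝓞 K)ˣ, ∃ n : ℤ, u = e ^ n ∨ u = -e ^ n := by
  rw [← Units.finrank_modTorsion, finrank_eq_one_iff'] at h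
  obtain ⟨v, -, hv⟩ := h
  obtain ⟨e, he⟩ := QuotientGroup.mk_surjective v.toMul
  refine ⟨e, fun u ↦ ?_⟩
  obtain ⟨n, hn⟩ := hv (Additive.ofMul (QuotientGroup.mk u))
  have h1 : (QuotientGroup.mk (e ^ n) : (𝓞 K)ˣ ⧸ Units.torsion K) = QuotientGroup.mk u := by
    rw [QuotientGroup.mk_zpow, he]
    exact congrArg Additive.toMul hn
  rw [QuotientGroup.eq] at h1
  refine ⟨n, ?_⟩
  rcases eq_one_or_neg_one_of_mem_torsion φ h1 with h2 | h2
  · left; exact (inv_mul_eq_one.mp h2).symm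
  · right
    rw [inv_mul_eq_iff_eq_mul] at h2
    rw [h2, mul_neg, mul_one]

theorem exists_eq_sq_of_norm_neg_one (φ : K →+* ℝ) (h : Units.rank K = 1) (σ : 𝓞 K ≃+* 𝓞 K)
    {ε : (𝓞 K)ˣ} (hε : (ε : 𝓞 K) * σ ε = -1) (u : (𝓞 K)ˣ) :
    ∃ v : (𝓞 K)ˣ, u = v ^ 2 ∨ u = -v ^ 2 ∨ u = ε * v ^ 2 ∨ u = -ε * v ^ 2 := by
  obtain ⟨e, he⟩ := exists_fundamental_unit φ h
  obtain ⟨m, hm⟩ := he ε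
  obtain ⟨n, hn⟩ := he u
  -- For m even, ε·σ(ε) = -1 would be a square in a field with a real embedding. So ε and the
  -- fundamental unit agree up to sign and squares.
  have hodd : Odd m := by
    rw [← Int.not_even_iff_odd]
    rintro ⟨j, rfl⟩
    have h1 : (((e ^ j : (𝓞 K)ˣ) : 𝓞 K) * σ (e ^ j : (𝓞 K)ˣ)) ^ 2 = -1 := by
      rw [← hε]
      rcases hm with rfl | rfl
      · simp only [zpow_add, Units.val_mul, map_mul]; ring
      · simp only [zpow_add, Units.val_mul, Units.val_neg, map_mul, map_neg]; ring
    have h2 := congrArg (fun x : 𝓞 K ↦ φ (x : K)) h1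
    simp only [map_pow, map_neg, map_one] at h2
    nlinarith [sq_nonneg (φ ((((e ^ j : (𝓞 K)ˣ) : 𝓞 K) * σ (e ^ j : (𝓞 K)ˣ) : 𝓞 K) : K))]
  obtain ⟨j, rfl⟩ := hodd
  rcases Int.even_or_odd' n with ⟨i, rfl | rfl⟩
  · refine ⟨e ^ i, ?_⟩
    rw [← zpow_natCast, ← zpow_mul, mul_comm]
    push_cast
    tauto
  · refine ⟨e ^ (i - j), ?_⟩
    have h1 : e ^ (2 * i + 1) = e ^ (2 * j + 1) * (e ^ (i - j)) ^ 2 := by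
      rw [← zpow_natCast, ← zpow_mul, ← zpow_add]
      congr 1
      push_cast
      ring
    rw [h1] at hn
    rcases hn with rfl | rfl <;> rcases hm with hm | hm <;> simp [hm]

theorem eq_zero_of_forall_two_pow_smul {M : Type*} [AddCommGroup M] [Module.Free ℤ M] {x : M}
    (h : ∀ n : ℕ, ∃ y, x = (2 ^ n : ℤ) • y) : x = 0 := by
  set b := Module.Free.chooseBasis ℤ M
  rw [← b.repr.map_eq_zero_iff]
  ext i
  -- A coordinate c divisible by 2^|c| > |c| vanishes.
  obtain ⟨y, hy⟩ := h (b.repr x i).natAbs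
  refine Int.eq_zero_of_abs_lt_dvd (m := 2 ^ (b.repr x i).natAbs) ?_ ?_
  · refine ⟨b.repr y i, ?_⟩
    conv_lhs => rw [hy]
    simp
  · rw [Int.abs_eq_natAbs]
    exact_mod_cast Nat.lt_two_pow_self

variable {L : Type*} [Field L] [NumberField L] [Algebra K L]

/-- Dirichlet's unit theorem gives a unit of relative norm one that is, up to sign, not the square
of such a unit. -/
theorem exists_norm_one_not_sq (h : Units.rank K < Units.rank L)
    {σ : 𝓞 L ≃+* 𝓞 L} (hσ : ∀ x, σ (σ x) = x)
    (hfix : ∀ x, σ x = x → ∃ a, algebraMap (𝓞 K) (𝓞 L) a = x) :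
    ∃ η : (𝓞 L)ˣ, (η : 𝓞 L) * σ η = 1 ∧
      ∀ v : (𝓞 L)ˣ, (v : 𝓞 L) * σ v = 1 → η ≠ v ^ 2 ∧ η ≠ -v ^ 2 := by
  have hinj : Function.Injective (algebraMap (𝓞 K) (𝓞 L)) := FaithfulSMul.algebraMap_injective _ _
  have hex : ∀ w : (𝓞 L)ˣ, ∃ u : (𝓞 K)ˣ, algebraMap (𝓞 K) (𝓞 L) u = w * σ w := fun w ↦
    exists_unit_of_fixed hinj hfix (w * Units.map (σ : 𝓞 L →* 𝓞 L) w) (by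
      simp [hσ, mul_comm])
  choose N hN using hex
  have hN1 : ∀ w, N w = 1 ↔ (w : 𝓞 L) * σ w = 1 := fun w ↦ by
    rw [← hN, ← Units.val_eq_one, ← map_one (algebraMap (𝓞 K) (𝓞 L)), hinj.eq_iff]
  let N' : (𝓞 L)ˣ →* (𝓞 K)ˣ := MonoidHom.mk' N fun a b ↦ Units.ext (hinj (by
    rw [Units.val_mul, map_mul, hN, hN, hN, Units.val_mul, map_mul]; ring))
  let g : Additive (𝓞 L)ˣ →ₗ[ℤ] Additive (𝓞 K)ˣ := N'.toAdditive.toIntLinearMap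
  -- The kernel of the norm has rank at least the difference of the unit ranks, which is positive.
  obtain ⟨X, hX1, hX⟩ : ∃ X : (𝓞 L)ˣ, N X = 1 ∧ X ∉ Units.torsion L := by
    by_contra! hcon
    have h1 := (LinearMap.ker g).finrank_quotient_add_finrank
    rw [g.quotKerEquivRange.finrank_eq] at h1
    rw [Units.finrank_eq] at h1
    have h2 := Submodule.finrank_le (LinearMap.range g)
    rw [Units.finrank_eq] at h2
    have h3 : Module.finrank ℤ (LinearMap.ker g) = 0 := by
      rw [Module.finrank_eq_zero_iff]
      rintro ⟨x, hx⟩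
      have hx' : N x.toMul = 1 := congrArg Additive.toMul (LinearMap.mem_ker.mp hx)
      obtain ⟨n, hn, hxn⟩ := isOfFinOrder_iff_pow_eq_one.mp (hcon _ hx')
      refine ⟨n, by exact_mod_cast hn.ne', Subtype.ext ?_⟩
      rw [natCast_zsmul]
      exact hxn
    omega
  by_contra! hcon
  have hmk : ∀ v : (𝓞 L)ˣ, (QuotientGroup.mk (-v) : (𝓞 L)ˣ ⧸ Units.torsion L) =
      QuotientGroup.mk v := fun v ↦ by
    rw [QuotientGroup.eq]
    refine isOfFinOrder_iff_pow_eq_one.mpr ⟨2, two_pos, ?_⟩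
    rw [inv_neg, neg_mul, inv_mul_cancel, neg_one_sq]
  -- If all units of norm one were ± squares of such units, X would be infinitely 2-divisible in the
  -- free group of units modulo torsion.
  have hdesc : ∀ n : ℕ, ∃ v : (𝓞 L)ˣ, (v : 𝓞 L) * σ v = 1 ∧
      (QuotientGroup.mk X : (𝓞 L)ˣ ⧸ Units.torsion L) = QuotientGroup.mk (v ^ 2 ^ n) := by
    intro n
    induction n with
    | zero => exact ⟨X, (hN1 X).mp hX1, by simp⟩
    | succ n ih =>
      obtain ⟨v, hv, he⟩ := ih
      obtain ⟨w, hw, hvw⟩ := hcon v hv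
      refine ⟨w, hw, ?_⟩
      rw [he, pow_succ', pow_mul, QuotientGroup.mk_pow, QuotientGroup.mk_pow]
      congr 1
      by_cases h' : v = w ^ 2
      · rw [h']
      · rw [hvw h', hmk]
  apply hX
  rw [← QuotientGroup.eq_one_iff]
  refine congrArg Additive.toMul (eq_zero_of_forall_two_pow_smul
    (x := Additive.ofMul (QuotientGroup.mk X : (𝓞 L)ˣ ⧸ Units.torsion L)) fun n ↦ ?_)
  obtain ⟨v, -, hv⟩ := hdesc n
  refine ⟨Additive.ofMul (QuotientGroup.mk v), ?_⟩
  rw [hv, QuotientGroup.mk_pow]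
  have : (2 ^ n : ℤ) = ((2 ^ n : ℕ) : ℤ) := by push_cast; rfl
  rw [this, natCast_zsmul]
  rfl

end RealPlaces

/-! ### Quadratic extensions generated by a square root -/

section QuadraticExtension

variable {F K : Type*} [Field F] [Field K] [Algebra F K]

theorem exists_involution [CharZero F] (hdeg : Module.finrank F K = 2) {a : F} {t : K}
    (ht : t ^ 2 = algebraMap F K a) (ht' : t ∉ Set.range (algebraMap F K)) :
    ∃ σ : K ≃ₐ[F] K, (∀ x, σ (σ x) = x) ∧ σ t = -t ∧ (∀ x, σ x = x → ∃ r, algebraMap F K r = x) ∧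
      (∀ x, algebraMap F K (Algebra.norm F x) = x * σ x) := by
  have : Algebra.IsQuadraticExtension F K := ⟨hdeg⟩
  have : FiniteDimensional F K := Module.finite_of_finrank_eq_succ hdeg
  have hcard : Nat.card (K ≃ₐ[F] K) = 2 := by rw [IsGalois.card_aut_eq_finrank, hdeg]
  obtain ⟨σ, hσ⟩ : ∃ σ : K ≃ₐ[F] K, σ ≠ 1 :=
    have : Nontrivial (K ≃ₐ[F] K) := Finite.one_lt_card_iff_nontrivial.mp (by omega)
    exists_ne 1
  have hall : ∀ τ : K ≃ₐ[F] K, τ = 1 ∨ τ = σ := by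
    obtain ⟨a, b, -, hab⟩ := Nat.card_eq_two_iff.mp hcard
    have hz : ∀ z : K ≃ₐ[F] K, z = a ∨ z = b := fun z ↦ by
      simpa using (hab ▸ Set.mem_univ z : z ∈ ({a, b} : Set _))
    intro τ
    rcases hz τ with h | h <;> rcases hz 1 with h' | h' <;> rcases hz σ with h'' | h'' <;> simp_all
  have hfix : ∀ x, σ x = x → ∃ r, algebraMap F K r = x := by
    intro x hx
    refine (IsGalois.mem_range_algebraMap_iff_fixed x).mpr fun τ ↦ ?_
    rcases hall τ with rfl | rfl
    · rfl
    · exact hx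
  refine ⟨σ, fun x ↦ ?_, ?_, hfix, fun x ↦ ?_⟩
  · have h : σ ^ 2 = 1 := by rw [← hcard]; exact pow_card_eq_one'
    rw [sq] at h
    exact congrArg (fun f : K ≃ₐ[F] K ↦ f x) h
  · have h : σ t ^ 2 = t ^ 2 := by rw [← map_pow, ht, AlgEquiv.commutes]
    rcases sq_eq_sq_iff_eq_or_eq_neg.mp h with h | h
    · exact absurd (hfix t h) ht'
    · exact h
  · classical
    rw [Algebra.norm_eq_prod_automorphisms]
    have : (Finset.univ : Finset (K ≃ₐ[F] K)) = {1, σ} := by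
      ext τ
      simpa using hall τ
    rw [this, Finset.prod_pair hσ.symm]
    rfl

theorem finrank_adjoin_sqrt {a : F} {t : K}
    (ht : t ^ 2 = algebraMap F K a) (ht' : t ∉ Set.range (algebraMap F K)) :
    Module.finrank F (IntermediateField.adjoin F {t}) = 2 := by
  have hroot : Polynomial.aeval t (Polynomial.X ^ 2 - Polynomial.C a) = 0 := by simp [ht]
  have hmonic := Polynomial.monic_X_pow_sub_C a two_ne_zero
  have hint : IsIntegral F t := ⟨_, hmonic, hroot⟩
  rw [IntermediateField.adjoin.finrank hint]
  refine le_antisymm ?_ ((minpoly.two_le_natDegree_iff hint).mpr ht')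
  have := Polynomial.natDegree_le_of_dvd (minpoly.dvd F t hroot) hmonic.ne_zero
  rwa [Polynomial.natDegree_X_pow_sub_C] at this

end QuadraticExtension

/-! ### Signs of norms, and the proof for k(√ε) -/

theorem exists_eq_sq_of_eq_mul_norm {k L : Type*} [Field k] [NumberField k] [Field L]
    [NumberField L] [Algebra k L] {τ : k →+* ℝ} {ε : (𝓞 k)ˣ} (hτ : τ ((ε : 𝓞 k) : k) < 0)
    (hsq : ∀ u : (𝓞 k)ˣ, ∃ v : (𝓞 k)ˣ, u = v ^ 2 ∨ u = -v ^ 2 ∨ u = ε * v ^ 2 ∨ u = -ε * v ^ 2)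
    {σ : L ≃ₐ[k] L} (hσ : ∀ x, σ (σ x) = x) (hfix : ∀ x, σ x = x → ∃ r, algebraMap k L r = x)
    {t : L} (ht : t ^ 2 = algebraMap k L ((ε : 𝓞 k) : k)) (hσt : σ t = -t) (u : (𝓞 k)ˣ) {x y : L}
    (hx : x ≠ 0) (h : y * σ y = algebraMap k L ((u : 𝓞 k) : k) * (x * σ x)) :
    ∃ v : (𝓞 k)ˣ, u = v ^ 2 ∨ u = -ε * v ^ 2 := by
  have ht0 : t ≠ 0 := by
    rintro rfl
    have : ((ε : 𝓞 k) : k) = 0 := (algebraMap k L).injective (by rw [← ht, map_zero]; simp)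
    rw [this, map_zero] at hτ
    exact lt_irrefl _ hτ
  -- With z = (a + bt)/2, the norm is (a² - εb²)/4, nonnegative under `τ` because τ(ε) < 0.
  have hnorm : ∀ z : L, ∃ r : k, algebraMap k L r = z * σ z ∧ 0 ≤ τ r := by
    intro z
    obtain ⟨a, ha⟩ := hfix (z + σ z) (by rw [map_add, hσ, add_comm])
    obtain ⟨b, hb⟩ := hfix ((z - σ z) / t) (by
      rw [map_div₀, map_sub, hσ, hσt, div_neg, ← neg_div, neg_sub])
    refine ⟨(a ^ 2 - b ^ 2 * ((ε : 𝓞 k) : k)) / 4, ?_, ?_⟩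
    · rw [map_div₀, map_sub, map_mul, map_pow, map_pow, ha, hb, ← ht, map_ofNat]
      field_simp
      ring
    · rw [map_div₀, map_sub, map_mul, map_pow, map_pow, map_ofNat]
      have := mul_nonneg (sq_nonneg (τ b)) (neg_nonneg.mpr hτ.le)
      have := sq_nonneg (τ a)
      linarith
  obtain ⟨r, hr, hr0⟩ := hnorm x
  obtain ⟨s, hs, hs0⟩ := hnorm y
  have hsr : s = ((u : 𝓞 k) : k) * r := (algebraMap k L).injective (by rw [hs, h, map_mul, hr])
  have hr1 : 0 < τ r := by
    refine lt_of_le_of_ne hr0 fun h0 ↦ ?_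
    have : r = 0 := τ.injective (by rw [← h0, map_zero])
    rw [this, map_zero] at hr
    exact mul_ne_zero hx (by simpa using hx) hr.symm
  have hu : 0 ≤ τ ((u : 𝓞 k) : k) := by
    rw [hsr, map_mul] at hs0
    exact nonneg_of_mul_nonneg_left hs0 hr1
  obtain ⟨v, hv⟩ := hsq u
  have hv0 : 0 < τ ((v : 𝓞 k) : k) ^ 2 := by
    have : τ ((v : 𝓞 k) : k) ≠ 0 := by simp
    positivity
  refine ⟨v, ?_⟩
  rcases hv with hv | hv | hv | hv
  · exact Or.inl hv
  · rw [hv] at hu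
    simp only [Units.val_neg, Units.val_pow_eq_pow_val, map_neg, map_pow] at hu
    linarith
  · rw [hv] at hu
    simp only [Units.val_mul, Units.val_pow_eq_pow_val, map_mul, map_pow] at hu
    linarith [mul_neg_of_neg_of_pos hτ hv0]
  · exact Or.inr hv

theorem NumberField.RingOfIntegers.exists_algebraMap_eq {k L : Type*} [Field k] [Field L]
    [Algebra k L] {x : 𝓞 L} {r : k} (h : algebraMap k L r = x) :
    ∃ a, algebraMap (𝓞 k) (𝓞 L) a = x := by
  have hr : IsIntegral ℤ r := by
    rw [← isIntegral_algebraMap_iff (algebraMap k L).injective, h]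
    exact x.isIntegral_coe
  exact ⟨⟨r, hr⟩, NumberField.RingOfIntegers.ext h⟩

theorem NumberField.RingOfIntegers.exists_intCast_eq {k : Type*} [Field k] [NumberField k]
    {x : 𝓞 k} {r : ℚ} (h : algebraMap ℚ k r = x) : ∃ n : ℤ, algebraMap ℤ (𝓞 k) n = x := by
  have hr : IsIntegral ℤ r := by
    rw [← isIntegral_algebraMap_iff (algebraMap ℚ k).injective, h]
    exact x.isIntegral_coe
  obtain ⟨n, rfl⟩ := IsIntegrallyClosed.isIntegral_iff.mp hr
  refine ⟨n, NumberField.RingOfIntegers.ext ?_⟩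
  rw [← h]
  simp

/-- Otherwise -1, the norm of ε, would be a square in ℚ. -/
theorem sqrt_notMem_range_of_norm_neg_one {k M : Type*} [Field k] [NumberField k] [Field M]
    [Algebra k M] {ε : 𝓞 k} (hε : Algebra.norm ℤ ε = -1) {t : M}
    (ht : t ^ 2 = algebraMap k M (ε : k)) : t ∉ Set.range (algebraMap k M) := by
  rintro ⟨r, rfl⟩
  rw [← map_pow] at ht
  have h := congrArg (Algebra.norm ℚ) ((algebraMap k M).injective ht)
  rw [← Algebra.coe_norm_int, hε, map_pow] at h
  have := sq_nonneg (Algebra.norm ℚ r)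
  norm_num [h] at this

theorem odd_classNumber_of_real_sqrt_unit {k L : Type*} [Field k] [NumberField k] [Field L]
    [NumberField L] [Algebra k L] (φ : L →+* ℝ) {p : ℕ} (hp : p.Prime) (hp8 : p ≡ 1 [MOD 8])
    (hk : Module.finrank ℚ k = 2) {s : k} (hs : s ^ 2 = p) {ε : (𝓞 k)ˣ}
    (hε_norm : Algebra.norm ℤ (ε : 𝓞 k) = -1) (hL : Module.finrank k L = 2) {t : L}
    (ht : t ^ 2 = algebraMap k L ((ε : 𝓞 k) : k)) : Odd (NumberField.classNumber L) := by
  have hs' : s ∉ Set.range (algebraMap ℚ k) := by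
    rintro ⟨r, rfl⟩
    rw [← map_pow, ← map_natCast (algebraMap ℚ k)] at hs
    have h := (algebraMap ℚ k).injective hs
    refine hp.irrational_sqrt ⟨|r|, ?_⟩
    rw [Rat.cast_abs, ← Real.sqrt_sq_eq_abs]
    exact_mod_cast congrArg (fun x : ℚ ↦ √(x : ℝ)) h
  obtain ⟨σ, hσ, hσs, hσfix, hσnorm⟩ := exists_involution hk (a := (p : ℚ)) (by simpa using hs) hs'
  have hεσ : ((ε : 𝓞 k) : k) * σ ((ε : 𝓞 k) : k) = -1 := by
    rw [← hσnorm]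
    have h := Algebra.coe_norm_int (ε : 𝓞 k)
    rw [hε_norm] at h
    rw [← h]
    simp
  let ψ : k →+* ℝ := φ.comp (algebraMap k L)
  let τ : k →+* ℝ := ψ.comp (σ : k →+* k)
  have hψε : 0 < ψ ((ε : 𝓞 k) : k) := by
    have h : ψ ((ε : 𝓞 k) : k) = φ t ^ 2 := by rw [← map_pow, ht]; rfl
    rw [h]
    have ht0 : φ t ≠ 0 := by
      intro h0
      rw [h0] at h
      simp [ψ] at h
    positivity
  -- The two real conjugates of ε have product -1, and the one that extends to L is φ(t)² > 0.
  have hτε : τ ((ε : 𝓞 k) : k) < 0 := by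
    have h := congrArg ψ hεσ
    rw [map_mul, map_neg, map_one] at h
    have h' : ψ (σ ((ε : 𝓞 k) : k)) < 0 := by
      by_contra! hcon
      nlinarith
    exact h'
  have ht' := sqrt_notMem_range_of_norm_neg_one hε_norm ht
  obtain ⟨ρ, hρ, hρt, hρfix, -⟩ := exists_involution hL ht ht'
  let σ' : 𝓞 k ≃+* 𝓞 k := NumberField.RingOfIntegers.mapRingEquiv σ.toRingEquiv
  let ρ' : 𝓞 L ≃+* 𝓞 L := NumberField.RingOfIntegers.mapRingEquiv ρ.toRingEquiv
  have hσ' : ∀ x, σ' (σ' x) = x := fun x ↦ NumberField.RingOfIntegers.ext (hσ x)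
  have hρ' : ∀ x, ρ' (ρ' x) = x := fun x ↦ NumberField.RingOfIntegers.ext (hρ x)
  have hσfix' : ∀ x, σ' x = x → ∃ n : ℤ, algebraMap ℤ (𝓞 k) n = x := fun x hx ↦ by
    obtain ⟨r, hr⟩ := hσfix x (congrArg (algebraMap (𝓞 k) k) hx)
    exact NumberField.RingOfIntegers.exists_intCast_eq hr
  have hρfix' : ∀ x, ρ' x = x → ∃ a, algebraMap (𝓞 k) (𝓞 L) a = x := fun x hx ↦ by
    obtain ⟨r, hr⟩ := hρfix x (congrArg (algebraMap (𝓞 L) L) hx)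
    exact NumberField.RingOfIntegers.exists_algebraMap_eq hr
  have hρk : ∀ a, ρ' (algebraMap (𝓞 k) (𝓞 L) a) = algebraMap (𝓞 k) (𝓞 L) a := fun a ↦
    NumberField.RingOfIntegers.ext (ρ.commutes a)
  have hεσ' : (ε : 𝓞 k) * σ' ε = -1 := NumberField.RingOfIntegers.ext hεσ
  obtain ⟨m, hm⟩ : ∃ m : ℕ, p = 8 * m + 1 := by
    refine ⟨p / 8, ?_⟩
    have : p % 8 = 1 := hp8
    omega
  have hsint : IsIntegral ℤ s := ⟨Polynomial.X ^ 2 - Polynomial.C (p : ℤ),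
    Polynomial.monic_X_pow_sub_C _ two_ne_zero, by simp [hs]⟩
  -- Here p ≡ 1 mod 8 enters: ω² - ω = (p - 1)/4 is even, so 2 splits.
  have hωsq : ((1 + s) / 2) ^ 2 = (1 + s) / 2 + 2 * (m : k) := by
    rw [hm] at hs
    push_cast at hs
    linear_combination hs / 4
  have hωint : IsIntegral ℤ ((1 + s) / 2) := by
    refine ⟨Polynomial.X ^ 2 - (Polynomial.X + Polynomial.C (2 * m : ℤ)), ?_, ?_⟩
    · refine Polynomial.monic_X_pow_sub ?_
      rw [← one_mul Polynomial.X, ← Polynomial.C_1]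
      exact Polynomial.degree_linear_le.trans_lt (by norm_num)
    · simp [hωsq]
  let s' : 𝓞 k := ⟨s, hsint⟩
  let ω : 𝓞 k := ⟨(1 + s) / 2, hωint⟩
  have hσs' : σ' s' = -s' := NumberField.RingOfIntegers.ext hσs
  have hω : 2 * ω = 1 + s' := NumberField.RingOfIntegers.ext (mul_div_cancel₀ _ two_ne_zero)
  have hω2 : ω ^ 2 = ω + 2 * (m : 𝓞 k) := NumberField.RingOfIntegers.coe_injective (by
    rw [map_pow, map_add, map_mul, map_ofNat, map_natCast]
    exact hωsq)
  have hσω : σ' ω = 1 - ω := by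
    have h := congrArg σ' hω
    rw [map_mul, map_ofNat, map_add, map_one, hσs'] at h
    refine mul_left_cancel₀ (two_ne_zero (α := 𝓞 k)) ?_
    linear_combination h + hω
  have hkodd : Odd (NumberField.classNumber k) :=
    odd_classNumber_of_sq_eq_prime hσ' hσfix' hk hp (s := s') (ω := ω)
      (NumberField.RingOfIntegers.coe_injective (by rw [map_pow, map_natCast]; exact hs)) hω hσs' ε
      hεσ'
  obtain ⟨q, q', hqq, hq, h₁, h₂, h₃⟩ := exists_split_two hk hω2 hσω ε hεσ'
  have hrank : NumberField.Units.rank k = 1 := rank_eq_one_of_real ψ hk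
  have hrankL : 1 < NumberField.Units.rank L := by
    -- Two distinct real embeddings, t ↦ ±φ(t), in degree 4 already force unit rank at least 2.
    refine one_lt_rank_of_real (φ := φ) (ψ := φ.comp (ρ : L →+* L)) ?_
      (by rw [← Module.finrank_mul_finrank ℚ k L, hk, hL])
    intro h
    have h' : t = -t := φ.injective (by rw [← hρt]; exact congrArg (fun f : L →+* ℝ ↦ f t) h)
    exact ht' ⟨0, by rw [map_zero]; exact (self_eq_neg.mp h').symm⟩
  obtain ⟨η, hη, hη'⟩ := exists_norm_one_not_sq (K := k) (hrank ▸ hrankL) hρ' hρfix'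
  have htint : IsIntegral ℤ t := by
    refine IsIntegral.of_pow two_pos ?_
    rw [ht]
    exact (ε : 𝓞 k).isIntegral_coe.algebraMap
  let t' : 𝓞 L := ⟨t, htint⟩
  have ht'sq : t' ^ 2 = algebraMap (𝓞 k) (𝓞 L) ε := NumberField.RingOfIntegers.ext ht
  have ht'unit : IsUnit t' := by
    rw [← isUnit_pow_iff two_ne_zero, ht'sq]
    exact ε.isUnit.map _
  obtain ⟨T, hT⟩ := ht'unit
  refine odd_classNumber_sqrt_unit hρ' hρfix' hρk hL hkodd hqq hq h₁ h₂ h₃ (t := T)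
    (by rw [hT, ht'sq]) (by rw [hT]; exact NumberField.RingOfIntegers.ext hρt) ?_ hη hη'
  intro u x y hx h
  refine exists_eq_sq_of_eq_mul_norm hτε (exists_eq_sq_of_norm_neg_one ψ hrank σ' hεσ') hρ hρfix ht
    hρt u (x := x) (y := y) (by simpa using hx) ?_
  exact congrArg (algebraMap (𝓞 L) L) h

theorem theorem8 (p : ℕ) (hp : p.Prime) (hp8 : p ≡ 1 [MOD 8])
    (ε : (𝓞 (quadField p))ˣ)
    (hε_pos : 0 < (((ε : 𝓞 (quadField p)) : quadField p) : ℝ))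
    (hε_norm : Algebra.norm ℤ (ε : 𝓞 (quadField p)) = -1) :
    Odd (NumberField.classNumber (sqrtExt p ((ε : 𝓞 (quadField p)) : quadField p))) := by
  have hsq : √(p : ℝ) ^ 2 = algebraMap ℚ ℝ p := by simp
  have hk : Module.finrank ℚ (quadField p) = 2 :=
    finrank_adjoin_sqrt hsq (fun ⟨r, hr⟩ ↦ hp.irrational_sqrt ⟨r, hr⟩)
  have htsq : √(((ε : 𝓞 (quadField p)) : quadField p) : ℝ) ^ 2 =
      algebraMap (quadField p) ℝ ((ε : 𝓞 (quadField p)) : quadField p) := Real.sq_sqrt hε_pos.le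
  have hL : Module.finrank (quadField p) (sqrtExt p ((ε : 𝓞 (quadField p)) : quadField p)) = 2 :=
    finrank_adjoin_sqrt htsq (sqrt_notMem_range_of_norm_neg_one hε_norm htsq)
  exact odd_classNumber_of_real_sqrt_unit
    (algebraMap (sqrtExt p ((ε : 𝓞 (quadField p)) : quadField p)) ℝ) hp hp8 hk
    (s := IntermediateField.AdjoinSimple.gen ℚ √(p : ℝ)) (Subtype.ext (by simp)) hε_norm hL
    (t := IntermediateField.AdjoinSimple.gen (quadField p)
      √(((ε : 𝓞 (quadField p)) : quadField p) : ℝ)) (Subtype.ext htsq)
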